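/- Consider a polling system with one server and queues $Q_1,\dots,Q_M$ ($M\ge 1$, indices modulo $M$). Jobs arrive to $Q_j$ according to independent Poisson processes with rates $\lambda_j>0$, and the service requirements at $Q_i$ are independent and exponential with mean $b_i>0$. The server visits the queues cyclically and uses the autonomous-server discipline: it stays at $Q_i$ for an independent exponential time with rate $\alpha_i>0$, even when $Q_i$ is or becomes empty; a service that is interrupted at the end of a visit starts anew with a new requirement at the next visit. Thus during a visit to $Q_i$ the vector $\mathbf N(t)\in\{0,1,\dots\}^M$ of queue lengths is the continuous-time Markov chain with transition rates $\lambda_j$ from $\mathbf n$ to $\mathbf n+e_j$ ($1\le j\le M$) and $1/b_i$ from $\mathbf n$ to $\mathbf n-e_i$ if $n_i\ge 1$, stopped at an independent exponential time with rate $\alpha_i$. The switch-over time $C^{i}\ge 0$ from $Q_i$ to $Q_{i+1}$ has an arbitrary distribution and is independent of everything else. For $\mathbf z\in\mathbb C^M$ with $|z_j|\le 1$ for all $j$ put $$s_i:=\lambda_i+\tfrac1{b_i}+\alpha_i+\sum_{m\ne i}\lambda_m(1-z_m),\qquad P_i(r):=\lambda_i r^2-s_i r+\tfrac1{b_i},\qquad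 r_{1i}:=\frac{s_i-\sqrt{s_i^2-4\lambda_i/b_i}}{2\lambda_i}$$ (principal square root), and let $\mathbf z_i^*$ be $\mathbf z$ with $z_i$ replaced by $r_{1i}$. Let $C^{i}(\mathbf z)$ be the joint p.g.f. of the numbers of Poisson arrivals to the queues during $C^{i}$. (1) $|r_{1i}|<1$, and $r_{1i}$ is the unique root of $P_i$ in the closed unit disk. (2) Let the joint queue length at the begin of a visit to $Q_i$ have any law, with p.g.f. $\beta$, and let $\gamma$ be the joint p.g.f. at the end of this visit. Then, for $z_i\ne 1$ and $z_i\neq r_{1i}$, $$\gamma(\mathbf z)=\frac{\alpha_i(1-z_i)}{P_i(z_i)}\left(\frac{r_{1i}\,\beta(\mathbf z_i^*)}{1-r_{1i}}-\frac{z_i\,\beta(\mathbf z)}{1-z_i}\right),$$ and at every $\mathbf z$ (in particular if $z_i=1$ or $z_i=r_{1i}$) $\gamma(\mathbf z)$ is the limit of the right-hand side with $z_i$ replaced by $w$, as $w\to z_i$ with $|w|\le1$ and $w\ne 1,r_{1i}$. (3) Suppose the system is in steady state, and let $\beta^A_i$ and $\gamma^A_i$ be the joint p.g.f.s of the queue lengths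 at the begin and at the end of a visit to $Q_i$; that is, the underlying laws reproduce themselves through the visits and switch-overs of a cycle. Then (2) holds with $\beta=\beta^A_i$, $\gamma=\gamma_i^A$. Moreover $\beta^A_i(\mathbf z)=\gamma^A_{i-1}(\mathbf z)\,C^{i-1}(\mathbf z)$, and, for $z_i\ne r_{1i}$, $$\gamma^A_i(\mathbf z)=\frac{\alpha_i(1-z_i)\,r_{1i}}{P_i(z_i)(1-r_{1i})}\,\gamma^A_{i-1}(\mathbf z_i^*)\,C^{i-1}(\mathbf z_i^*)-\frac{\alpha_i z_i}{P_i(z_i)}\,\gamma^A_{i-1}(\mathbf z)\,C^{i-1}(\mathbf z),$$ where again $\gamma^A_i(\mathbf z)$ is at every $\mathbf z$ the limit of the right-hand side with $z_i$ replaced by $w$, as $w\to z_i$ with $|w|\le1$ and $w\ne 1,r_{1i}$. -/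

import Mathlib

open MeasureTheory ProbabilityTheory Filter Topology
open scoped NNReal ENNReal

noncomputable section

/-! ### Continuous-time Markov chains given by their transition rates -/

/-- The total rate `∑ₘ q n m` out of the state `n`, where `q n m` (for `m ≠ n`) are the transition
rates and `q n n = 0`. -/
def exitRate {E : Type*} (q : E → E → ℝ≥0) (n : E) : ℝ≥0 := ∑' m, q n m

/-- For `t ≥ 0`: the probability that the continuous-time Markov chain with transition rates `q`,
started from `n`, is in state `m` at time `t` and has made fewer than `k` jumps by then.
The recursion conditions on the first jump: the chain stays in `n` for an exponentially distributed
time with rate `exitRate q n`, and the jump to `l` takes place in `ds` with probability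
`exp (-exitRate q n * s) * q n l ds`. -/
def transProbAux {E : Type*} [DecidableEq E] (q : E → E → ℝ≥0) : ℕ → ℝ → E → E → ℝ≥0∞
  | 0, _, _, _ => 0
  | k + 1, t, n, m =>
      (if n = m then ENNReal.ofReal (Real.exp (-(exitRate q n : ℝ) * t)) else 0) +
        ∫⁻ s in Set.Icc 0 t, ENNReal.ofReal (Real.exp (-(exitRate q n : ℝ) * s)) *
          ∑' l, (q n l : ℝ≥0∞) * transProbAux q k (t - s) l m

/-- The transition probability `P(X(t) = m | X(0) = n)` of the continuous-time Markov chain `X`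
with transition rates `q`. -/
def transProb {E : Type*} [DecidableEq E] (q : E → E → ℝ≥0) (t : ℝ) (n m : E) : ℝ≥0∞ :=
  ⨆ k, transProbAux q k t n m

/-! ### The polling system -/

/-- The numbers of jobs in the queues. -/
abbrev QState (M : ℕ) : Type := Fin M → ℕ

/-- The data of a cyclic single-server polling system with `M` queues under the autonomous-server
discipline. -/
structure AutonomousPolling (M : ℕ) where
  /-- arrival rate of the Poisson process of jobs arriving to each queue -/
  lam : Fin M → ℝ≥0
  /-- mean of the exponentially distributed service requirements at each queue -/
  b : Fin M → ℝ≥0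
  /-- rate of the exponentially distributed time that the server stays at each queue -/
  alpha : Fin M → ℝ≥0
  /-- law of the switch-over time from each queue to the next one -/
  switchLaw : Fin M → Measure ℝ≥0
  lam_pos : ∀ i, 0 < lam i
  b_pos : ∀ i, 0 < b i
  alpha_pos : ∀ i, 0 < alpha i
  switchLaw_prob : ∀ i, IsProbabilityMeasure (switchLaw i)

namespace AutonomousPolling

variable {M : ℕ} (S : AutonomousPolling M)

/-- The transition rates of the joint queue length while the server is at queue `i`: a job arrives
to queue `j` with rate `lam j`; a job leaves queue `i` with rate `1 / b i` when queue `i` is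
nonempty. -/
def visitRate (i : Fin M) (n m : QState M) : ℝ≥0 :=
  (∑ j, if m = n + Pi.single j 1 then S.lam j else 0) +
    if 0 < n i ∧ m = n - Pi.single i 1 then (S.b i)⁻¹ else 0

/-- The law of the joint queue length at the end of a visit to queue `i` that begins with joint
queue length `n`, that is, the law of `N(T)` where `N` is the Markov chain with rates `visitRate i`
and `N(0) = n`, and `T` is independent of `N` and exponentially distributed with rate `alpha i`. -/
def endOfVisit (i : Fin M) (n : QState M) : Measure (QState M) :=
  Measure.sum fun m =>
    (∫⁻ t, transProb (S.visitRate i) t n m ∂(expMeasure (S.alpha i : ℝ))) • Measure.dirac m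

/-- The law of the numbers of Poisson arrivals to the queues during the switch-over time from queue
`i` to the next one: given that this time equals `c`, they are independent and Poisson distributed
with parameters `lam j * c`. -/
def switchArrivals (i : Fin M) : Measure (QState M) :=
  (S.switchLaw i).bind fun c => Measure.pi fun j => poissonMeasure (S.lam j * c)

/-- `β i` and `γ i` are steady-state laws of the joint queue length at the begin and at the end of a
visit to queue `i`: they are consistent with the evolution of the system through a visit and
through the switch-over from queue `i - 1` to queue `i` (indices modulo `M`). -/
structure IsSteadyState [NeZero M] (β γ : Fin M → Measure (QState M)) : Prop where
  prob : ∀ i, IsProbabilityMeasure (β i)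
  visit : ∀ i, γ i = (β i).bind (S.endOfVisit i)
  switch : ∀ i, β i = (γ (i - 1)).conv (S.switchArrivals (i - 1))

/-- `s_i = λ_i + 1/b_i + α_i + ∑_{m ≠ i} λ_m (1 - z_m)`. -/
def s (i : Fin M) (z : Fin M → ℂ) : ℂ :=
  ((S.lam i : ℝ) : ℂ) + 1 / ((S.b i : ℝ) : ℂ) + ((S.alpha i : ℝ) : ℂ) +
    ∑ m ∈ Finset.univ.erase i, ((S.lam m : ℝ) : ℂ) * (1 - z m)

/-- `P_i(r) = λ_i r² - s_i r + 1/b_i`. -/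
def P (i : Fin M) (z : Fin M → ℂ) (r : ℂ) : ℂ :=
  ((S.lam i : ℝ) : ℂ) * r ^ 2 - S.s i z * r + 1 / ((S.b i : ℝ) : ℂ)

/-- `r_{1i} = (s_i - √(s_i² - 4 λ_i / b_i)) / (2 λ_i)`, with the principal square root. -/
def r1 (i : Fin M) (z : Fin M → ℂ) : ℂ :=
  (S.s i z - ((S.s i z) ^ 2 - 4 * ((S.lam i : ℝ) : ℂ) / ((S.b i : ℝ) : ℂ)) ^ (1 / 2 : ℂ)) /
    (2 * ((S.lam i : ℝ) : ℂ))

/-- `z*_i`: the vector `z` with `i`-th coordinate replaced by `r_{1i}`. -/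
def zStar (i : Fin M) (z : Fin M → ℂ) : Fin M → ℂ := Function.update z i (S.r1 i z)

/-- `α_i (1 - z_i) / P_i(z_i) * (r_{1i} B(z*_i) / (1 - r_{1i}) - z_i B(z) / (1 - z_i))`. -/
def visitMap (i : Fin M) (B : (Fin M → ℂ) → ℂ) (z : Fin M → ℂ) : ℂ :=
  ((S.alpha i : ℝ) : ℂ) * (1 - z i) / S.P i z (z i) *
    (S.r1 i z * B (S.zStar i z) / (1 - S.r1 i z) - z i * B z / (1 - z i))

/-- `α_i (1 - z_i) r_{1i} / (P_i(z_i) (1 - r_{1i})) * G(z*_i) * C(z*_i)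
  - α_i z_i / P_i(z_i) * G(z) * C(z)`. -/
def cycleMap (i : Fin M) (G C : (Fin M → ℂ) → ℂ) (z : Fin M → ℂ) : ℂ :=
  ((S.alpha i : ℝ) : ℂ) * (1 - z i) * S.r1 i z / (S.P i z (z i) * (1 - S.r1 i z)) *
      G (S.zStar i z) * C (S.zStar i z) -
    ((S.alpha i : ℝ) : ℂ) * z i / S.P i z (z i) * G z * C z

end AutonomousPolling

/-- The joint probability generating function `z ↦ E[∏ⱼ zⱼ ^ Nⱼ]` of a law on `ℕ^M`. -/
def pgf {M : ℕ} (ν : Measure (QState M)) (z : Fin M → ℂ) : ℂ := ∫ n, ∏ j, z j ^ n j ∂ν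

end

/-!
The joint queue length during a visit to queue `i` is a Markov chain with bounded rates, and its law
at the end of the visit is the law at an independent exponential time. First-step analysis gives the
backward equation of that law as a function of the initial state (`endOfVisit_backward`); it comes
from the recursion defining the transition probabilities, since the Laplace transform turns the
convolution over the first jump time into a product (`lintegral_transProbAux_succ`) and monotone
convergence removes the restriction on the number of jumps (`lintegral_transProb_backward`).

For a fixed point `z` of the closed polydisk, the generating function at the end of the visit is
thus, as a function of the initial state, a bounded solution of a linear difference equation, and
such a solution is unique (`eq_zero_of_backward`). An explicit solution is a combination of two
products of powers: with `z` itself, which accounts for the inhomogeneous term, and with `zStar`,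
where `z i` is replaced by a root of `P`, which solves the homogeneous equation away from `n i = 0`
and whose coefficient is adjusted at `n i = 0` (`visitSol_backward`). It is bounded because the root
`r1` lies in the unit disk (`quadratic_small_root`, `r1_spec`). Integrating over the initial state
gives the formula for a visit (`pgf_bind_endOfVisit`).

The exceptional values of `z i` are reached by continuity of generating functions on the closed
polydisk (`tendsto_pgf_update`), and the steady-state formulas follow because the generating
function of a convolution is the product (`pgf_conv`).
-/

/-! ### The resolvent of a Markov chain given by its transition rates -/

lemma measurable_exponentialPDF (r : ℝ) : Measurable (exponentialPDF r) :=
  (measurable_exponentialPDFReal r).ennreal_ofReal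

lemma lintegral_expMeasure (a : ℝ) (f : ℝ → ℝ≥0∞) :
    ∫⁻ t, f t ∂(expMeasure a) = ∫⁻ t, exponentialPDF a t * f t :=
  lintegral_withDensity_eq_lintegral_mul_non_measurable _ (measurable_exponentialPDF a)
    (Eventually.of_forall fun _ => ENNReal.ofReal_lt_top) f

section Resolvent

variable {E : Type*} [DecidableEq E] (q : E → E → ℝ≥0)

/-- Monotone convergence for unconditional sums of extended nonnegative numbers. -/
lemma tsum_iSup_of_monotone {ι : Type*} (f : ℕ → ι → ℝ≥0∞) (hf : Monotone f) :
    ∑' l, ⨆ k, f k l = ⨆ k, ∑' l, f k l := by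
  let _ : MeasurableSpace ι := ⊤
  simp_rw [← lintegral_count]
  exact lintegral_iSup (fun _ => measurable_from_top) hf

lemma monotone_transProbAux (t : ℝ) (n m : E) : Monotone fun k => transProbAux q k t n m := by
  refine monotone_nat_of_le_succ fun k => ?_
  induction k generalizing t n with
  | zero => simp [transProbAux]
  | succ k ih =>
    rw [transProbAux, transProbAux]
    gcongr
    exact ih _ _

variable [Countable E]

lemma measurable_transProbAux (k : ℕ) (n m : E) : Measurable fun t => transProbAux q k t n m := by
  induction k generalizing n with
  | zero => simp [transProbAux]
  | succ k ih =>
    simp only [transProbAux]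
    refine Measurable.add (by split_ifs <;> fun_prop) ?_
    have key : ∀ t : ℝ, (∫⁻ s in Set.Icc 0 t, ENNReal.ofReal (Real.exp (-(exitRate q n : ℝ) * s)) *
          ∑' l, (q n l : ℝ≥0∞) * transProbAux q k (t - s) l m) =
        ∫⁻ s, {p : ℝ × ℝ | 0 ≤ p.2 ∧ p.2 ≤ p.1}.indicator
          (fun p => ENNReal.ofReal (Real.exp (-(exitRate q n : ℝ) * p.2)) *
            ∑' l, (q n l : ℝ≥0∞) * transProbAux q k (p.1 - p.2) l m) (t, s) := by
      intro t
      rw [← lintegral_indicator measurableSet_Icc]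
      rfl
    simp_rw [key]
    refine Measurable.lintegral_prod_right' (Measurable.indicator ?_ ?_)
    · refine Measurable.mul (by fun_prop) (Measurable.tsum fun l => ?_)
      exact ((ih l).comp (measurable_fst.sub measurable_snd)).const_mul _
    · exact (measurableSet_le measurable_const measurable_snd).inter
        (measurableSet_le measurable_snd measurable_fst)

/-- Laplace transform of a convolution with an exponential function. -/
lemma lintegral_expMeasure_conv {a c : ℝ} (ha : 0 < a) (hc : 0 ≤ c) {h : ℝ → ℝ≥0∞}
    (hh : Measurable h) :
    ENNReal.ofReal (a + c) * ∫⁻ t, ∫⁻ s in Set.Icc 0 t, ENNReal.ofReal (Real.exp (-c * s)) * h (t - s)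
      ∂volume ∂(expMeasure a) = ∫⁻ t, h t ∂(expMeasure a) := by
  -- The weight `a * exp (-a * t)` splits as `exp (-a * s) * (a * exp (-a * (t - s)))`.
  have key : ∀ t : ℝ, ENNReal.ofReal (a + c) * (exponentialPDF a t *
      ∫⁻ s in Set.Icc 0 t, ENNReal.ofReal (Real.exp (-c * s)) * h (t - s)) =
      ∫⁻ s, exponentialPDF (a + c) s * (exponentialPDF a (t - s) * h (t - s)) := by
    intro t
    rw [← lintegral_indicator measurableSet_Icc, ← lintegral_const_mul', ← lintegral_const_mul']
    rotate_left
    · exact ENNReal.ofReal_ne_top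
    · exact ENNReal.ofReal_ne_top
    refine lintegral_congr fun s => ?_
    by_cases hs : s ∈ Set.Icc 0 t
    · rw [Set.indicator_of_mem hs, exponentialPDF_of_nonneg hs.1,
        exponentialPDF_of_nonneg (sub_nonneg.2 hs.2), exponentialPDF_of_nonneg (hs.1.trans hs.2),
        ← mul_assoc, ← mul_assoc, ← mul_assoc, ← ENNReal.ofReal_mul (by positivity),
        ← ENNReal.ofReal_mul (by positivity), ← ENNReal.ofReal_mul (by positivity)]
      congr 2
      have : Real.exp (-(a * t)) * Real.exp (-c * s) =
          Real.exp (-((a + c) * s)) * Real.exp (-(a * (t - s))) := by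
        rw [← Real.exp_add, ← Real.exp_add]; ring_nf
      linear_combination (a + c) * a * this
    · rw [Set.indicator_of_notMem hs]
      rw [Set.mem_Icc, not_and_or, not_le, not_le] at hs
      rcases hs with hs | hs
      · simp [exponentialPDF_of_neg hs]
      · simp [exponentialPDF_of_neg (sub_neg.2 hs)]
  rw [lintegral_expMeasure, ← lintegral_const_mul' _ _ ENNReal.ofReal_ne_top, lintegral_congr key,
    lintegral_lintegral_swap]
  · have : ∀ s, ∫⁻ t, exponentialPDF (a + c) s * (exponentialPDF a (t - s) * h (t - s)) =
        exponentialPDF (a + c) s * ∫⁻ t, exponentialPDF a t * h t := by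
      intro s
      rw [lintegral_const_mul' _ _ (show exponentialPDF (a + c) s ≠ ⊤ from ENNReal.ofReal_ne_top),
        lintegral_sub_right_eq_self (fun t => exponentialPDF a t * h t)]
    rw [lintegral_congr this, lintegral_mul_const _ (measurable_exponentialPDF _),
      lintegral_exponentialPDF_eq_one (by positivity), one_mul, lintegral_expMeasure]
  · refine Measurable.aemeasurable ?_
    refine ((measurable_exponentialPDF _).comp measurable_snd).mul ?_
    exact ((measurable_exponentialPDF _).mul hh).comp (measurable_fst.sub measurable_snd)

lemma lintegral_expMeasure_exp {a c : ℝ} (ha : 0 < a) (hc : 0 ≤ c) :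
    ENNReal.ofReal (a + c) * ∫⁻ t, ENNReal.ofReal (Real.exp (-c * t)) ∂(expMeasure a) =
      ENNReal.ofReal a := by
  rw [lintegral_expMeasure, ← lintegral_const_mul' _ _ ENNReal.ofReal_ne_top]
  have key : ∀ t : ℝ, ENNReal.ofReal (a + c) *
      (exponentialPDF a t * ENNReal.ofReal (Real.exp (-c * t))) =
      ENNReal.ofReal a * exponentialPDF (a + c) t := by
    intro t
    rcases lt_or_ge t 0 with ht | ht
    · simp [exponentialPDF_of_neg ht]
    · rw [exponentialPDF_of_nonneg ht, exponentialPDF_of_nonneg ht, ← mul_assoc,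
        ← ENNReal.ofReal_mul (by positivity), ← ENNReal.ofReal_mul (by positivity),
        ← ENNReal.ofReal_mul (by positivity)]
      congr 1
      have : Real.exp (-(a * t)) * Real.exp (-c * t) = Real.exp (-((a + c) * t)) := by
        rw [← Real.exp_add]; ring_nf
      linear_combination (a + c) * a * this
  rw [lintegral_congr key, lintegral_const_mul' _ _ ENNReal.ofReal_ne_top,
    lintegral_exponentialPDF_eq_one (by positivity), mul_one]

/-- The recursion for the law, at an independent exponential time, of the chain restricted to
fewer than `k` jumps. -/
lemma lintegral_transProbAux_succ {a : ℝ} (ha : 0 < a) (k : ℕ) (n m : E) :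
    ENNReal.ofReal (a + exitRate q n) * ∫⁻ t, transProbAux q (k + 1) t n m ∂(expMeasure a) =
      (if n = m then ENNReal.ofReal a else 0) +
        ∑' l, (q n l : ℝ≥0∞) * ∫⁻ t, transProbAux q k t l m ∂(expMeasure a) := by
  simp only [transProbAux]
  rw [lintegral_add_left (by split_ifs <;> fun_prop), mul_add, lintegral_expMeasure_conv
    (h := fun u => ∑' l, (q n l : ℝ≥0∞) * transProbAux q k u l m) ha (NNReal.coe_nonneg _)
    (Measurable.tsum fun l => (measurable_transProbAux q k l m).const_mul _),
    lintegral_tsum fun l => ((measurable_transProbAux q k l m).const_mul _).aemeasurable]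
  congr 1
  · split_ifs
    · exact lintegral_expMeasure_exp ha (NNReal.coe_nonneg _)
    · simp
  · exact tsum_congr fun l => lintegral_const_mul' _ _ ENNReal.coe_ne_top

lemma lintegral_transProb (a : ℝ) (n m : E) :
    ∫⁻ t, transProb q t n m ∂(expMeasure a) =
      ⨆ k, ∫⁻ t, transProbAux q k t n m ∂(expMeasure a) :=
  lintegral_iSup (fun k => measurable_transProbAux q k n m)
    fun _ _ h t => monotone_transProbAux q t n m h

/-- The backward equation for the law of the chain at an independent exponential time. -/
lemma lintegral_transProb_backward {a : ℝ} (ha : 0 < a) (n m : E) :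
    ENNReal.ofReal (a + exitRate q n) * ∫⁻ t, transProb q t n m ∂(expMeasure a) =
      (if n = m then ENNReal.ofReal a else 0) +
        ∑' l, (q n l : ℝ≥0∞) * ∫⁻ t, transProb q t l m ∂(expMeasure a) := by
  have hmono : ∀ l, Monotone fun k => ∫⁻ t, transProbAux q k t l m ∂(expMeasure a) :=
    fun l _ _ h => lintegral_mono fun t => monotone_transProbAux q t l m h
  simp_rw [lintegral_transProb]
  rw [← (hmono n).iSup_nat_add 1, ENNReal.mul_iSup]
  simp_rw [lintegral_transProbAux_succ q ha, ENNReal.mul_iSup]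
  rw [tsum_iSup_of_monotone
    (fun k l => (q n l : ℝ≥0∞) * ∫⁻ t, transProbAux q k t l m ∂(expMeasure a))
    fun _ _ h l => mul_le_mul_right (hmono l h) _, ENNReal.add_iSup]

/-- The transition probabilities sum to at most one (a defect would mean explosion), by induction on
the number of jumps. -/
lemma tsum_lintegral_transProb_le_one {a : ℝ} (ha : 0 < a) (hq : ∀ n, Summable (q n)) (n : E) :
    ∑' m, ∫⁻ t, transProb q t n m ∂(expMeasure a) ≤ 1 := by
  simp_rw [lintegral_transProb]
  rw [tsum_iSup_of_monotone _ fun _ _ h m =>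
    lintegral_mono fun t => monotone_transProbAux q t n m h]
  refine iSup_le fun k => ?_
  induction k generalizing n with
  | zero => simp [transProbAux]
  | succ k ih =>
    have h0 : ENNReal.ofReal (a + exitRate q n) ≠ 0 := by
      have := NNReal.coe_nonneg (exitRate q n)
      simp only [ne_eq, ENNReal.ofReal_eq_zero, not_le]
      linarith
    -- After multiplication by the total rate, the recursion bounds the sum by `a + ∑ l, q n l`.
    refine (ENNReal.mul_le_mul_iff_right h0 ENNReal.ofReal_ne_top).1 ?_
    rw [← ENNReal.tsum_mul_left]
    simp_rw [lintegral_transProbAux_succ q ha]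
    rw [ENNReal.tsum_add, ENNReal.tsum_comm, tsum_ite_eq', mul_one,
      ENNReal.ofReal_add ha.le (NNReal.coe_nonneg _), ENNReal.ofReal_coe_nnreal, exitRate,
      ENNReal.coe_tsum (hq n)]
    gcongr with l
    rw [ENNReal.tsum_mul_left]
    exact mul_le_of_le_one_right' (ih l)

end Resolvent

/-! ### The roots of `P` -/

/-- If `|s| > l + m`, a quadratic `l r² - s r + m` has exactly one root in the closed unit disk.
With `r₁ r₂ = m / l` and `r₁ + r₂ = s / l`, the inequality `|r₁ + r₂| > 1 + |r₁| |r₂|` forces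
`(1 - |r₁|) (1 - |r₂|) < 0`. The choice of the square root `w` makes `r₁` the smaller root. -/
lemma quadratic_small_root {l m : ℝ} (hl : 0 < l) (hm : 0 < m) {s w : ℂ} (hs : l + m < s.re)
    (hw : w ^ 2 = s ^ 2 - 4 * l * m) (hw0 : 0 ≤ w.re) :
    ‖(s - w) / (2 * l)‖ < 1 ∧ 1 < ‖(s + w) / (2 * l)‖ := by
  have hlC : (l : ℂ) ≠ 0 := by exact_mod_cast hl.ne'
  set r₁ := (s - w) / (2 * l) with h₁
  set r₂ := (s + w) / (2 * l) with h₂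
  have hsum : r₁ + r₂ = s / l := by rw [h₁, h₂]; field_simp; ring
  have hprod : r₁ * r₂ = (m / l : ℝ) := by
    rw [h₁, h₂]; push_cast; field_simp; linear_combination -hw
  -- `w ^ 2` and `s ^ 2` have the same imaginary part, and `s` and `w` have nonnegative real parts,
  -- so they lie in a common closed quadrant.
  have hre : 0 ≤ s.re * w.re + s.im * w.im := by
    have him : w.re * w.im = s.re * s.im := by
      have := congrArg Complex.im hw
      simp [pow_two] at this
      linarith
    have hsre : 0 < s.re := by linarith
    rcases hw0.eq_or_lt with h0 | h0
    · have : s.im = 0 := by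
        rw [← h0, zero_mul] at him
        simpa [hsre.ne'] using him.symm
      simp [← h0, this]
    · have h3 : 0 ≤ (s.re * w.re) * (s.im * w.im) := by
        have : (s.re * w.re) * (s.im * w.im) = (w.re * w.im) ^ 2 := by
          linear_combination -(w.re * w.im) * him
        rw [this]; positivity
      have h4 : 0 < s.re * w.re := by positivity
      have h5 : 0 ≤ s.im * w.im := nonneg_of_mul_nonneg_right h3 h4
      linarith
  -- `|s + w|² - |s - w|²` is four times the left-hand side of `hre`.
  have hle : ‖r₁‖ ≤ ‖r₂‖ := by
    rw [h₁, h₂, norm_div, norm_div]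
    gcongr ?_ / _
    rw [← sq_le_sq₀ (norm_nonneg _) (norm_nonneg _), ← Complex.normSq_eq_norm_sq,
      ← Complex.normSq_eq_norm_sq, Complex.normSq_apply, Complex.normSq_apply]
    simp only [Complex.sub_re, Complex.sub_im, Complex.add_re, Complex.add_im]
    nlinarith
  have hlt : 1 + ‖r₁‖ * ‖r₂‖ < ‖r₁‖ + ‖r₂‖ := by
    refine lt_of_lt_of_le ?_ (norm_add_le _ _)
    have h6 : ‖((m / l : ℝ) : ℂ)‖ = m / l := by
      rw [Complex.norm_real, Real.norm_of_nonneg (by positivity)]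
    have h7 : ‖(l : ℂ)‖ = l := by rw [Complex.norm_real, Real.norm_of_nonneg hl.le]
    rw [← norm_mul, hprod, hsum, norm_div, h6, h7, lt_div_iff₀ hl]
    have : s.re ≤ ‖s‖ := (le_abs_self _).trans (Complex.abs_re_le_norm s)
    have h8 : (1 + m / l) * l = l + m := by field_simp
    linarith
  constructor <;> nlinarith

namespace AutonomousPolling

variable {M : ℕ} (S : AutonomousPolling M)

lemma lt_s_re (i : Fin M) {z : Fin M → ℂ} (hz : ∀ j, ‖z j‖ ≤ 1) :
    (S.lam i : ℝ) + 1 / S.b i < (S.s i z).re := by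
  have hsum : 0 ≤ (∑ m ∈ Finset.univ.erase i, ((S.lam m : ℝ) : ℂ) * (1 - z m)).re := by
    rw [Complex.re_sum]
    refine Finset.sum_nonneg fun m _ => ?_
    rw [Complex.re_ofReal_mul]
    have := (le_abs_self _).trans ((Complex.abs_re_le_norm (z m)).trans (hz m))
    exact mul_nonneg (NNReal.coe_nonneg _) (by simpa using this)
  have h1 : ((1 : ℂ) / ((S.b i : ℝ) : ℂ)) = ((1 / S.b i : ℝ) : ℂ) := by push_cast; rfl
  have ha : (0 : ℝ) < S.alpha i := S.alpha_pos i
  rw [s, h1, Complex.add_re, Complex.add_re, Complex.add_re, Complex.ofReal_re, Complex.ofReal_re,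
    Complex.ofReal_re]
  linarith

/-- `r1` is the root of `P` in the open unit disk, and the other root lies outside the closed
unit disk. -/
lemma r1_spec (i : Fin M) {z : Fin M → ℂ} (hz : ∀ j, ‖z j‖ ≤ 1) :
    ‖S.r1 i z‖ < 1 ∧ S.P i z (S.r1 i z) = 0 ∧
      ∀ w : ℂ, ‖w‖ ≤ 1 → S.P i z w = 0 → w = S.r1 i z := by
  have hl : (0 : ℝ) < S.lam i := S.lam_pos i
  have hb : (0 : ℝ) < S.b i := S.b_pos i
  have hlC : ((S.lam i : ℝ) : ℂ) ≠ 0 := by exact_mod_cast hl.ne'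
  have hbC : ((S.b i : ℝ) : ℂ) ≠ 0 := by exact_mod_cast hb.ne'
  set D : ℂ := (S.s i z) ^ 2 - 4 * ((S.lam i : ℝ) : ℂ) / ((S.b i : ℝ) : ℂ) with hD
  set v : ℂ := D ^ (1 / 2 : ℂ) with hv
  have hv2 : v ^ 2 = D := by
    have := Complex.cpow_nat_inv_pow D two_ne_zero
    rwa [Nat.cast_ofNat, ← one_div] at this
  -- The principal square root has argument in `(-π / 2, π / 2]`.
  have hv0 : 0 ≤ v.re := by
    have := Complex.cpow_ofReal_re D (1 / 2)
    push_cast at this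
    rw [hv, this]
    refine mul_nonneg (by positivity) (Real.cos_nonneg_of_mem_Icc ⟨?_, ?_⟩) <;>
    · have h1 := Complex.arg_le_pi D
      have h2 := Complex.neg_pi_lt_arg D
      linarith
  have hv2' : v ^ 2 = S.s i z ^ 2 - 4 * ((S.lam i : ℝ) : ℂ) * ((1 / S.b i : ℝ) : ℂ) := by
    rw [hv2, hD]; push_cast; ring
  obtain ⟨h1, h2⟩ := quadratic_small_root hl (one_div_pos.2 hb) (S.lt_s_re i hz) hv2' hv0
  have hr : S.r1 i z = (S.s i z - v) / (2 * ((S.lam i : ℝ) : ℂ)) := rfl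
  have hfac : ∀ w, S.P i z w = ((S.lam i : ℝ) : ℂ) * ((w - S.r1 i z) *
      (w - (S.s i z + v) / (2 * ((S.lam i : ℝ) : ℂ)))) := by
    intro w
    rw [hD] at hv2
    rw [hr, P]
    field_simp
    field_simp at hv2
    linear_combination hv2
  refine ⟨by rwa [hr], by rw [hfac]; simp, fun w hw hP => ?_⟩
  rw [hfac, mul_eq_zero, mul_eq_zero, or_iff_right hlC] at hP
  rcases hP with hP | hP
  · exact sub_eq_zero.1 hP
  · rw [← sub_eq_zero.1 hP] at h2
    exact absurd hw (not_le.2 h2)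

@[simp] lemma s_update (i : Fin M) (z : Fin M → ℂ) (w : ℂ) :
    S.s i (Function.update z i w) = S.s i z := by
  unfold s
  congr 1
  refine Finset.sum_congr rfl fun m hm => ?_
  rw [Function.update_of_ne (Finset.ne_of_mem_erase hm)]

@[simp] lemma P_update (i : Fin M) (z : Fin M → ℂ) (w : ℂ) :
    S.P i (Function.update z i w) = S.P i z := by
  funext r; simp [P]

@[simp] lemma r1_update (i : Fin M) (z : Fin M → ℂ) (w : ℂ) :
    S.r1 i (Function.update z i w) = S.r1 i z := by
  simp [r1]

@[simp] lemma zStar_update (i : Fin M) (z : Fin M → ℂ) (w : ℂ) :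
    S.zStar i (Function.update z i w) = S.zStar i z := by
  simp [zStar]

end AutonomousPolling

/-! ### Probability generating functions -/

section Pgf

variable {M : ℕ}

lemma norm_prod_pow_le_one {z : Fin M → ℂ} (hz : ∀ j, ‖z j‖ ≤ 1) (n : QState M) :
    ‖∏ j, z j ^ n j‖ ≤ 1 := by
  rw [norm_prod]
  exact Finset.prod_le_one (fun _ _ => norm_nonneg _) fun j _ => by
    rw [norm_pow]; exact pow_le_one₀ (norm_nonneg _) (hz j)

lemma integrable_of_norm_le (μ : Measure (QState M)) [IsFiniteMeasure μ] {f : QState M → ℂ} {C : ℝ}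
    (hf : ∀ n, ‖f n‖ ≤ C) : Integrable f μ :=
  Integrable.of_bound (measurable_of_countable f).aestronglyMeasurable C (Eventually.of_forall hf)

lemma norm_pgf_le_one (μ : Measure (QState M)) (hμ : μ Set.univ ≤ 1) {z : Fin M → ℂ}
    (hz : ∀ j, ‖z j‖ ≤ 1) : ‖pgf μ z‖ ≤ 1 := by
  have : IsFiniteMeasure μ := ⟨hμ.trans_lt ENNReal.one_lt_top⟩
  refine (norm_integral_le_of_norm_le_const
    (Eventually.of_forall fun n => norm_prod_pow_le_one hz n)).trans ?_
  rw [one_mul]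
  exact ENNReal.toReal_le_of_le_ofReal zero_le_one (by simpa using hμ)

lemma norm_update_le_one {z : Fin M → ℂ} (hz : ∀ j, ‖z j‖ ≤ 1) (i : Fin M) {w : ℂ} (hw : ‖w‖ ≤ 1)
    (j : Fin M) : ‖Function.update z i w j‖ ≤ 1 := by
  rcases eq_or_ne j i with rfl | h
  · simpa using hw
  · simpa [h] using hz j

/-- A generating function is continuous up to the boundary of the polydisk in each variable. -/
lemma tendsto_pgf_update (μ : Measure (QState M)) [IsFiniteMeasure μ] {z : Fin M → ℂ}
    (hz : ∀ j, ‖z j‖ ≤ 1) (i : Fin M) {A : Set ℂ} (hA : ∀ w ∈ A, ‖w‖ ≤ 1) :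
    Tendsto (fun w => pgf μ (Function.update z i w)) (𝓝[A] (z i)) (𝓝 (pgf μ z)) := by
  have h : ContinuousWithinAt (fun w => pgf μ (Function.update z i w)) A (z i) := by
    refine continuousWithinAt_of_dominated (bound := fun _ => 1) ?_ ?_ (integrable_const _) ?_
    · exact Eventually.of_forall fun w => (measurable_of_countable _).aestronglyMeasurable
    · filter_upwards [self_mem_nhdsWithin] with w hw
      exact Eventually.of_forall fun n =>
        norm_prod_pow_le_one (norm_update_le_one hz i (hA w hw)) n
    · refine Eventually.of_forall fun n => Continuous.continuousWithinAt ?_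
      refine continuous_finsetProd _ fun j _ => Continuous.pow ?_ _
      exact (continuous_apply j).comp
        (continuous_const.update (f := fun _ : ℂ => z) i continuous_id)
  have h' := h.tendsto
  rwa [Function.update_eq_self] at h'

lemma pgf_conv (μ ν : Measure (QState M)) [IsFiniteMeasure μ] [IsFiniteMeasure ν] {z : Fin M → ℂ}
    (hz : ∀ j, ‖z j‖ ≤ 1) : pgf (μ.conv ν) z = pgf μ z * pgf ν z := by
  unfold pgf
  rw [integral_conv (integrable_of_norm_le _ (norm_prod_pow_le_one hz))]
  simp_rw [Pi.add_apply, pow_add, Finset.prod_mul_distrib, integral_const_mul, integral_mul_const]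

lemma pgf_bind (ν : Measure (QState M)) [IsFiniteMeasure ν] (κ : QState M → Measure (QState M))
    (hκ : ∀ n, κ n Set.univ ≤ 1) {z : Fin M → ℂ} (hz : ∀ j, ‖z j‖ ≤ 1) :
    pgf (ν.bind κ) z = ∫ n, pgf (κ n) z ∂ν := by
  -- A kernel on a countable discrete space; the bind is the second marginal of `ν ⊗ₘ K`.
  let K : Kernel (QState M) (QState M) := ⟨κ, measurable_of_countable κ⟩
  have : IsFiniteKernel K := ⟨⟨1, ENNReal.one_lt_top, hκ⟩⟩
  change pgf (ν.bind K) z = _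
  unfold pgf
  rw [← Measure.snd_compProd, Measure.snd, integral_map measurable_snd.aemeasurable
    (measurable_of_countable _).aestronglyMeasurable, Measure.integral_compProd]
  · rfl
  · exact Integrable.of_bound (measurable_of_countable _).aestronglyMeasurable 1
      (Eventually.of_forall fun p => norm_prod_pow_le_one hz p.2)

/-- No measurability of `κ` is needed, as a bind is at most the integral of the masses. -/
lemma bind_univ_le_one {α : Type*} [MeasurableSpace α] (ν : Measure α) [IsProbabilityMeasure ν]
    (κ : α → Measure (QState M)) (hκ : ∀ n, κ n Set.univ ≤ 1) : (ν.bind κ) Set.univ ≤ 1 := by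
  refine (Measure.bind_apply_le κ MeasurableSet.univ).trans ((lintegral_mono hκ).trans ?_)
  simp

end Pgf

namespace AutonomousPolling

variable {M : ℕ} (S : AutonomousPolling M)

/-! ### The backward equation of a visit -/

lemma tsum_visitRate_mul (i : Fin M) (n : QState M) (f : QState M → ℝ≥0∞) :
    ∑' l, (S.visitRate i n l : ℝ≥0∞) * f l = ∑ j, (S.lam j : ℝ≥0∞) * f (n + Pi.single j 1) +
      ((if 0 < n i then (S.b i)⁻¹ else 0 : ℝ≥0) : ℝ≥0∞) * f (n - Pi.single i 1) := by
  have h : ∀ l, (S.visitRate i n l : ℝ≥0∞) * f l =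
      (∑ j, if l = n + Pi.single j 1 then (S.lam j : ℝ≥0∞) * f (n + Pi.single j 1) else 0) +
      if l = n - Pi.single i 1 then ((if 0 < n i then (S.b i)⁻¹ else 0 : ℝ≥0) : ℝ≥0∞) *
        f (n - Pi.single i 1) else 0 := by
    intro l
    rw [visitRate, ENNReal.coe_add, add_mul, ENNReal.ofNNReal_finsetSum, Finset.sum_mul]
    congr 1
    · refine Finset.sum_congr rfl fun j _ => ?_
      split_ifs with h
      · rw [h]
      · simp
    · by_cases h1 : l = n - Pi.single i 1
      · simp [h1]
      · simp [h1]
  simp_rw [h]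
  rw [ENNReal.tsum_add, Summable.tsum_finsetSum fun _ _ => ENNReal.summable, tsum_ite_eq]
  simp_rw [tsum_ite_eq]

lemma tsum_visitRate (i : Fin M) (n : QState M) :
    ∑' l, (S.visitRate i n l : ℝ≥0∞) =
      ((∑ j, S.lam j + if 0 < n i then (S.b i)⁻¹ else 0 : ℝ≥0) : ℝ≥0∞) := by
  have := S.tsum_visitRate_mul i n fun _ => 1
  simp only [mul_one] at this
  rw [this, ENNReal.coe_add, ENNReal.ofNNReal_finsetSum]

lemma summable_visitRate (i : Fin M) (n : QState M) : Summable (S.visitRate i n) := by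
  rw [← ENNReal.tsum_coe_ne_top_iff_summable, tsum_visitRate]
  exact ENNReal.coe_ne_top

lemma exitRate_visitRate (i : Fin M) (n : QState M) :
    exitRate (S.visitRate i) n = ∑ j, S.lam j + if 0 < n i then (S.b i)⁻¹ else 0 := by
  have := S.tsum_visitRate i n
  rw [← ENNReal.coe_tsum (S.summable_visitRate i n)] at this
  exact ENNReal.coe_injective this

lemma endOfVisit_singleton (i : Fin M) (n m : QState M) :
    S.endOfVisit i n {m} =
      ∫⁻ t, transProb (S.visitRate i) t n m ∂(expMeasure (S.alpha i : ℝ)) :=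
  Measure.sum_smul_dirac_singleton

lemma endOfVisit_univ_le_one (i : Fin M) (n : QState M) : S.endOfVisit i n Set.univ ≤ 1 := by
  rw [endOfVisit, Measure.sum_apply _ MeasurableSet.univ]
  simpa using tsum_lintegral_transProb_le_one (S.visitRate i)
    (NNReal.coe_pos.2 (S.alpha_pos i)) (S.summable_visitRate i) n

instance (i : Fin M) (n : QState M) : IsFiniteMeasure (S.endOfVisit i n) :=
  ⟨(S.endOfVisit_univ_le_one i n).trans_lt ENNReal.one_lt_top⟩

/-- First-step analysis of a visit: what happens first is the end of the visit, an arrival, or a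
departure from queue `i`. -/
lemma endOfVisit_backward (i : Fin M) (n : QState M) :
    (S.alpha i + (∑ j, S.lam j + if 0 < n i then (S.b i)⁻¹ else 0)) • S.endOfVisit i n =
      S.alpha i • Measure.dirac n + (∑ j, S.lam j • S.endOfVisit i (n + Pi.single j 1) +
        (if 0 < n i then (S.b i)⁻¹ else 0 : ℝ≥0) • S.endOfVisit i (n - Pi.single i 1)) := by
  refine Measure.ext_of_singleton fun m => ?_
  have h := lintegral_transProb_backward (S.visitRate i)
    (NNReal.coe_pos.2 (S.alpha_pos i)) n m
  rw [tsum_visitRate_mul, exitRate_visitRate, ← NNReal.coe_add, ENNReal.ofReal_coe_nnreal,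
    ENNReal.ofReal_coe_nnreal] at h
  simp only [Measure.coe_add, Measure.coe_finsetSum, Pi.add_apply, Finset.sum_apply,
    Measure.smul_apply, endOfVisit_singleton, ENNReal.smul_def, smul_eq_mul]
  rw [h]
  congr 1
  by_cases hnm : n = m
  · simp [hnm]
  · simp [hnm]

lemma pgf_endOfVisit_backward (i : Fin M) (n : QState M) {z : Fin M → ℂ} (hz : ∀ j, ‖z j‖ ≤ 1) :
    ((S.alpha i + (∑ j, S.lam j + if 0 < n i then (S.b i)⁻¹ else 0) : ℝ≥0) : ℂ) *
        pgf (S.endOfVisit i n) z =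
      (S.alpha i : ℂ) * ∏ j, z j ^ n j +
        (∑ j, (S.lam j : ℂ) * pgf (S.endOfVisit i (n + Pi.single j 1)) z +
          ((if 0 < n i then (S.b i)⁻¹ else 0 : ℝ≥0) : ℂ) *
            pgf (S.endOfVisit i (n - Pi.single i 1)) z) := by
  have hint : ∀ (μ : Measure (QState M)) [IsFiniteMeasure μ],
      Integrable (fun n : QState M => ∏ j, z j ^ n j) μ :=
    fun μ _ => integrable_of_norm_le μ (norm_prod_pow_le_one hz)
  have h := congrArg (fun μ => pgf μ z) (S.endOfVisit_backward i n)
  simp only [pgf] at h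
  rw [integral_add_measure (hint _) (hint _), integral_add_measure (hint _) (hint _),
    integral_finsetSum_measure fun _ _ => hint _] at h
  simp only [integral_smul_nnreal_measure, integral_dirac] at h
  simpa only [NNReal.smul_def, Complex.real_smul, pgf] using h

/-- The backward equation of a visit has at most one bounded solution: the total rate out of a state
is bounded, so the equation is a contraction for the supremum norm. -/
lemma eq_zero_of_backward (i : Fin M) {D : QState M → ℂ} {C : ℝ} (hC : ∀ n, ‖D n‖ ≤ C)
    (h : ∀ n, ((S.alpha i + (∑ j, S.lam j + if 0 < n i then (S.b i)⁻¹ else 0) : ℝ≥0) : ℂ) * D n =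
      ∑ j, (S.lam j : ℂ) * D (n + Pi.single j 1) +
        ((if 0 < n i then (S.b i)⁻¹ else 0 : ℝ≥0) : ℂ) * D (n - Pi.single i 1)) (n : QState M) :
    D n = 0 := by
  have hbdd : BddAbove (Set.range fun n => ‖D n‖) := ⟨C, by rintro _ ⟨n, rfl⟩; exact hC n⟩
  set B : ℝ := ⨆ n, ‖D n‖ with hB
  have hle : ∀ n, ‖D n‖ ≤ B := le_ciSup hbdd
  have hB0 : 0 ≤ B := (norm_nonneg _).trans (hle 0)
  set a : ℝ := (S.alpha i : ℝ) with ha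
  have ha0 : 0 < a := NNReal.coe_pos.2 (S.alpha_pos i)
  set q : ℝ := ((∑ j, S.lam j + (S.b i)⁻¹ : ℝ≥0) : ℝ) with hq
  have hq0 : 0 ≤ q := NNReal.coe_nonneg _
  have hstep : ∀ n, ‖D n‖ ≤ q / (a + q) * B := by
    intro n
    set e : ℝ≥0 := if 0 < n i then (S.b i)⁻¹ else 0 with he
    set c : ℝ := ((∑ j, S.lam j + e : ℝ≥0) : ℝ) with hc
    have hc0 : 0 ≤ c := NNReal.coe_nonneg _
    have hcq : c ≤ q := by
      rw [hc, hq]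
      have : e ≤ (S.b i)⁻¹ := by rw [he]; split_ifs <;> simp
      exact_mod_cast add_le_add_right this _
    -- `c` is the rate out of `n`, and `q` bounds it uniformly in `n`.
    have h1 : (a + c) * ‖D n‖ ≤ c * B := by
      have h2 := congrArg norm (h n)
      rw [norm_mul, ← he] at h2
      have h3 : ‖((S.alpha i + (∑ j, S.lam j + e) : ℝ≥0) : ℂ)‖ = a + c := by
        rw [Complex.norm_real, NNReal.norm_eq, NNReal.coe_add]
      rw [h3] at h2
      rw [h2, hc, NNReal.coe_add, add_mul, NNReal.coe_sum, Finset.sum_mul]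
      refine (norm_add_le _ _).trans (add_le_add ((norm_sum_le _ _).trans
        (Finset.sum_le_sum fun j _ => ?_)) ?_)
      · rw [norm_mul, Complex.norm_real, NNReal.norm_eq]
        exact mul_le_mul_of_nonneg_left (hle _) (NNReal.coe_nonneg _)
      · rw [norm_mul, Complex.norm_real, NNReal.norm_eq]
        exact mul_le_mul_of_nonneg_left (hle _) (NNReal.coe_nonneg _)
    have h4 : ‖D n‖ ≤ c / (a + c) * B := by
      rw [div_mul_eq_mul_div, le_div_iff₀ (by positivity), mul_comm]
      exact h1
    refine h4.trans (mul_le_mul_of_nonneg_right ?_ hB0)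
    rw [div_le_div_iff₀ (by positivity) (by positivity)]
    nlinarith
  have hB1 : B ≤ q / (a + q) * B := ciSup_le hstep
  have hlt : q / (a + q) < 1 := by
    rw [div_lt_one (by positivity)]; linarith
  have hB2 : B = 0 := by nlinarith
  exact norm_le_zero_iff.1 (hB2 ▸ hle n)

/-! ### The generating function at the end of a visit -/

/-- The candidate for the generating function at the end of a visit to queue `i` that begins in the
state `n`. -/
noncomputable def visitSol (i : Fin M) (z : Fin M → ℂ) (n : QState M) : ℂ :=
  (S.alpha i : ℂ) / S.P i z (z i) *
    ((1 - z i) * S.r1 i z / (1 - S.r1 i z) * ∏ j, S.zStar i z j ^ n j - z i * ∏ j, z j ^ n j)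

lemma norm_zStar_le_one (i : Fin M) {z : Fin M → ℂ} (hz : ∀ j, ‖z j‖ ≤ 1) (j : Fin M) :
    ‖S.zStar i z j‖ ≤ 1 :=
  norm_update_le_one hz i (S.r1_spec i hz).1.le j

lemma P_ne_zero (i : Fin M) {z : Fin M → ℂ} (hz : ∀ j, ‖z j‖ ≤ 1) {w : ℂ} (hw : ‖w‖ ≤ 1)
    (hr : w ≠ S.r1 i z) : S.P i z w ≠ 0 :=
  fun h => hr ((S.r1_spec i hz).2.2 w hw h)

lemma r1_ne_one (i : Fin M) {z : Fin M → ℂ} (hz : ∀ j, ‖z j‖ ≤ 1) : S.r1 i z ≠ 1 := by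
  intro h
  have := (S.r1_spec i hz).1
  simp [h] at this

/-- The powers of the root `r1` solve the homogeneous equation in the interior, the powers of `z i`
solve the inhomogeneous one, and the coefficients are matched at the boundary `n i = 0`. -/
lemma visitSol_backward (i : Fin M) {z : Fin M → ℂ} (hz : ∀ j, ‖z j‖ ≤ 1)
    (hr : z i ≠ S.r1 i z) (n : QState M) :
    ((S.alpha i + (∑ j, S.lam j + if 0 < n i then (S.b i)⁻¹ else 0) : ℝ≥0) : ℂ) *
        S.visitSol i z n =
      (S.alpha i : ℂ) * ∏ j, z j ^ n j +
        (∑ j, (S.lam j : ℂ) * S.visitSol i z (n + Pi.single j 1) +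
          ((if 0 < n i then (S.b i)⁻¹ else 0 : ℝ≥0) : ℂ) *
            S.visitSol i z (n - Pi.single i 1)) := by
  have hP := S.P_ne_zero i hz (hz i) hr
  have hr1 := sub_ne_zero.2 (S.r1_ne_one i hz).symm
  have hroot := (S.r1_spec i hz).2.1
  set r := S.r1 i z with hrdef
  -- In terms of the length of queue `i` and the factor `R` of the other queues.
  set R : QState M → ℂ := fun m => ∏ j ∈ Finset.univ.erase i, z j ^ m j with hR
  set g : ℕ → ℂ := fun k => (S.alpha i : ℂ) / S.P i z (z i) *
    ((1 - z i) * r / (1 - r) * r ^ k - z i * z i ^ k) with hg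
  have hprod : ∀ m : QState M, ∏ j, z j ^ m j = z i ^ m i * R m := fun m =>
    (Finset.mul_prod_erase _ _ (Finset.mem_univ i)).symm
  have hprod' : ∀ m : QState M, ∏ j, S.zStar i z j ^ m j = r ^ m i * R m := by
    intro m
    rw [← Finset.mul_prod_erase _ _ (Finset.mem_univ i)]
    congr 1
    · simp [zStar, hrdef]
    · refine Finset.prod_congr rfl fun j hj => ?_
      rw [zStar, Function.update_of_ne (Finset.ne_of_mem_erase hj)]
  have hsol : ∀ m : QState M, S.visitSol i z m = g (m i) * R m := by
    intro m
    rw [visitSol, hprod, hprod', hg]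
    ring
  have hRi : ∀ m m' : QState M, (∀ j ≠ i, m j = m' j) → R m = R m' := fun m m' h =>
    Finset.prod_congr rfl fun j hj => by rw [h j (Finset.ne_of_mem_erase hj)]
  have hadd : S.visitSol i z (n + Pi.single i 1) = g (n i + 1) * R n := by
    rw [hsol, hRi (n + Pi.single i 1) n fun j hj => by simp [hj]]
    simp
  have hsub : S.visitSol i z (n - Pi.single i 1) = g (n i - 1) * R n := by
    rw [hsol, hRi (n - Pi.single i 1) n fun j hj => by simp [hj]]
    simp
  have hother : ∀ j ∈ Finset.univ.erase i, (S.lam j : ℂ) * S.visitSol i z (n + Pi.single j 1) =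
      (S.lam j : ℂ) * z j * (g (n i) * R n) := by
    intro j hj
    have hji : j ≠ i := Finset.ne_of_mem_erase hj
    have hRj : R (n + Pi.single j 1) = z j * R n := by
      simp only [hR]
      rw [← Finset.mul_prod_erase _ _ hj, ← Finset.mul_prod_erase _ (fun j => z j ^ n j) hj,
        ← mul_assoc]
      congr 1
      · simp [pow_succ']
      · refine Finset.prod_congr rfl fun l hl => ?_
        simp [Finset.ne_of_mem_erase hl]
    rw [hsol, hRj]
    simp [hji.symm]
    ring
  have hs : S.s i z = (S.lam i : ℂ) + (S.b i : ℂ)⁻¹ + (S.alpha i : ℂ) +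
      (∑ j ∈ Finset.univ.erase i, (S.lam j : ℂ) -
        ∑ j ∈ Finset.univ.erase i, (S.lam j : ℂ) * z j) := by
    rw [s, ← Finset.sum_sub_distrib, one_div]
    congr 1
    exact Finset.sum_congr rfl fun j _ => by simp [mul_sub]
  have hPz : S.P i z (z i) = (S.lam i : ℂ) * z i ^ 2 - S.s i z * z i + (S.b i : ℂ)⁻¹ := by
    rw [P, one_div]
  have hroot' : (S.lam i : ℂ) * r ^ 2 - S.s i z * r + (S.b i : ℂ)⁻¹ = 0 := by
    rw [← hroot, P, one_div]
  have hsum : ∑ j, (S.lam j : ℂ) * S.visitSol i z (n + Pi.single j 1) =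
      (S.lam i : ℂ) * (g (n i + 1) * R n) +
        (∑ j ∈ Finset.univ.erase i, (S.lam j : ℂ) * z j) * (g (n i) * R n) := by
    rw [Finset.sum_mul, ← Finset.sum_congr rfl hother, ← hadd]
    exact (Finset.add_sum_erase _ _ (Finset.mem_univ i)).symm
  rw [hsum, hsub, hsol, hprod, ← Finset.add_sum_erase _ _ (Finset.mem_univ i)]
  push_cast
  set lamSum := ∑ j ∈ Finset.univ.erase i, (S.lam j : ℂ)
  set zSum := ∑ j ∈ Finset.univ.erase i, (S.lam j : ℂ) * z j
  set l := (S.lam i : ℂ)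
  set a := (S.alpha i : ℂ)
  set x := z i
  set p := a / S.P i z x with hp
  have hpP : p * S.P i z x = a := div_mul_cancel₀ a hP
  set κ := (1 - x) / (1 - r) with hκdef
  have hκ : κ * (1 - r) = 1 - x := div_mul_cancel₀ _ hr1
  have hgκ : ∀ k, g k = p * (κ * r ^ (k + 1) - x ^ (k + 1)) := by
    intro k
    simp only [hg, hp, hκdef]
    ring
  rcases Nat.eq_zero_or_pos (n i) with h0 | h0
  -- At `n i = 0` no departure is possible, so the term `(S.b i)⁻¹` is missing from the rate.
  · have hg0 : (S.s i z - (S.b i : ℂ)⁻¹) * g 0 - l * g 1 = a := by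
      rw [hgκ, hgκ]
      linear_combination hpP - p * hPz - p * κ * hroot' + p * (S.b i : ℂ)⁻¹ * hκ
    simp only [h0, lt_irrefl, if_false]
    simp
    linear_combination R n * hg0 - R n * g 0 * hs
  · obtain ⟨k, hk⟩ : ∃ k, n i = k + 1 := ⟨n i - 1, by omega⟩
    have hgk : S.s i z * g (k + 1) - l * g (k + 2) - (S.b i : ℂ)⁻¹ * g k = a * x ^ (k + 1) := by
      rw [hgκ, hgκ, hgκ]
      linear_combination x ^ (k + 1) * hpP - p * x ^ (k + 1) * hPz -
        p * κ * r ^ (k + 1) * hroot'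
    simp only [hk, Nat.succ_pos, if_true, Nat.add_sub_cancel]
    push_cast
    linear_combination R n * hgk - R n * g (k + 1) * hs

/-- The generating function at the end of a visit, for a given state at its begin. -/
lemma pgf_endOfVisit (i : Fin M) {z : Fin M → ℂ} (hz : ∀ j, ‖z j‖ ≤ 1)
    (hr : z i ≠ S.r1 i z) (n : QState M) : pgf (S.endOfVisit i n) z = S.visitSol i z n := by
  rw [← sub_eq_zero]
  refine S.eq_zero_of_backward i (D := fun n => pgf (S.endOfVisit i n) z - S.visitSol i z n)
    (C := 1 + ‖(S.alpha i : ℂ) / S.P i z (z i)‖ *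
      (‖(1 - z i) * S.r1 i z / (1 - S.r1 i z)‖ * 1 + ‖z i‖ * 1)) (fun n => ?_) (fun n => ?_) n
  · refine (norm_sub_le _ _).trans
      (add_le_add (norm_pgf_le_one _ (S.endOfVisit_univ_le_one i n) hz) ?_)
    rw [visitSol, norm_mul]
    refine mul_le_mul_of_nonneg_left ((norm_sub_le _ _).trans ?_) (norm_nonneg _)
    rw [norm_mul, norm_mul]
    gcongr
    · exact norm_prod_pow_le_one (S.norm_zStar_le_one i hz) n
    · exact norm_prod_pow_le_one hz n
  · simp only [mul_sub, Finset.sum_sub_distrib]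
    linear_combination S.pgf_endOfVisit_backward i n hz - S.visitSol_backward i hz hr n

/-- The generating function at the end of a visit, with the factor `1 - z i` cancelled so that
`z i = 1` is included. -/
lemma pgf_bind_endOfVisit (ν : Measure (QState M)) [IsFiniteMeasure ν] (i : Fin M) {z : Fin M → ℂ}
    (hz : ∀ j, ‖z j‖ ≤ 1) (hr : z i ≠ S.r1 i z) :
    pgf (ν.bind (S.endOfVisit i)) z = (S.alpha i : ℂ) / S.P i z (z i) *
      ((1 - z i) * S.r1 i z / (1 - S.r1 i z) * pgf ν (S.zStar i z) - z i * pgf ν z) := by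
  rw [pgf_bind ν _ (S.endOfVisit_univ_le_one i) hz]
  simp_rw [S.pgf_endOfVisit i hz hr, visitSol]
  rw [integral_const_mul, integral_sub, integral_const_mul, integral_const_mul]
  · rfl
  · exact (integrable_of_norm_le ν
      (norm_prod_pow_le_one (S.norm_zStar_le_one i hz))).const_mul _
  · exact (integrable_of_norm_le ν (norm_prod_pow_le_one hz)).const_mul _

lemma pgf_bind_endOfVisit_eq_visitMap (ν : Measure (QState M)) [IsFiniteMeasure ν] (i : Fin M)
    {z : Fin M → ℂ} (hz : ∀ j, ‖z j‖ ≤ 1) (h1 : z i ≠ 1) (hr : z i ≠ S.r1 i z) :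
    pgf (ν.bind (S.endOfVisit i)) z = S.visitMap i (pgf ν) z := by
  have h1' := sub_ne_zero.2 h1.symm
  have hr1 := sub_ne_zero.2 (S.r1_ne_one i hz).symm
  have hP := S.P_ne_zero i hz (hz i) hr
  rw [S.pgf_bind_endOfVisit ν i hz hr, visitMap]
  change _ = (S.alpha i : ℂ) * _ / _ * _
  field_simp

lemma bind_endOfVisit_univ_le_one (ν : Measure (QState M)) [IsProbabilityMeasure ν] (i : Fin M) :
    (ν.bind (S.endOfVisit i)) Set.univ ≤ 1 :=
  bind_univ_le_one ν _ (S.endOfVisit_univ_le_one i)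

/-- If a function agrees with the generating function at the end of a visit off the exceptional
points, it extends to them continuously. -/
lemma tendsto_of_eq_pgf (μ : Measure (QState M)) [IsFiniteMeasure μ] (i : Fin M) {z : Fin M → ℂ}
    (hz : ∀ j, ‖z j‖ ≤ 1) {F : (Fin M → ℂ) → ℂ}
    (hF : ∀ z' : Fin M → ℂ, (∀ j, ‖z' j‖ ≤ 1) → z' i ≠ 1 → z' i ≠ S.r1 i z' → pgf μ z' = F z') :
    Tendsto (fun w => F (Function.update z i w))
      (𝓝[{w | ‖w‖ ≤ 1 ∧ w ≠ 1 ∧ w ≠ S.r1 i z}] (z i)) (𝓝 (pgf μ z)) := by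
  refine (tendsto_pgf_update μ hz i fun w hw => hw.1).congr' ?_
  filter_upwards [self_mem_nhdsWithin] with w hw
  exact hF _ (norm_update_le_one hz i hw.1) (by simpa using hw.2.1) (by simpa using hw.2.2)

instance (i : Fin M) : IsFiniteMeasure (S.switchArrivals i) := by
  have := S.switchLaw_prob i
  exact ⟨(bind_univ_le_one (S.switchLaw i) _ fun c => by simp).trans_lt
    ENNReal.one_lt_top⟩

end AutonomousPolling

theorem mainTheorem1 {M : ℕ} [NeZero M] (S : AutonomousPolling M) (i : Fin M)
    (z : Fin M → ℂ) (hz : ∀ j, ‖z j‖ ≤ 1) :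
    -- `r_{1i}` is the unique root of `P_i` in the unit disk, and it is not on the boundary
    (‖S.r1 i z‖ < 1 ∧ S.P i z (S.r1 i z) = 0 ∧
      ∀ w : ℂ, ‖w‖ ≤ 1 → S.P i z w = 0 → w = S.r1 i z) ∧
    -- a visit to queue `i` that begins with any law `ν` of the joint queue length
    (∀ ν : Measure (QState M), IsProbabilityMeasure ν →
      (z i ≠ 1 → z i ≠ S.r1 i z →
        pgf (ν.bind (S.endOfVisit i)) z = S.visitMap i (pgf ν) z) ∧
      Tendsto (fun w => S.visitMap i (pgf ν) (Function.update z i w))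
        (𝓝[{w | ‖w‖ ≤ 1 ∧ w ≠ 1 ∧ w ≠ S.r1 i z}] (z i))
        (𝓝 (pgf (ν.bind (S.endOfVisit i)) z))) ∧
    -- the steady state
    (∀ β γ : Fin M → Measure (QState M), S.IsSteadyState β γ →
      (z i ≠ 1 → z i ≠ S.r1 i z →
        pgf (γ i) z =
          ((S.alpha i : ℝ) : ℂ) * (1 - z i) / S.P i z (z i) *
            (S.r1 i z * pgf (β i) (S.zStar i z) / (1 - S.r1 i z)
              - z i * pgf (β i) z / (1 - z i))) ∧
      Tendsto (fun w => S.visitMap i (pgf (β i)) (Function.update z i w))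
        (𝓝[{w | ‖w‖ ≤ 1 ∧ w ≠ 1 ∧ w ≠ S.r1 i z}] (z i)) (𝓝 (pgf (γ i) z)) ∧
      pgf (β i) z = pgf (γ (i - 1)) z * pgf (S.switchArrivals (i - 1)) z ∧
      (z i ≠ S.r1 i z →
        pgf (γ i) z =
          ((S.alpha i : ℝ) : ℂ) * (1 - z i) * S.r1 i z / (S.P i z (z i) * (1 - S.r1 i z)) *
              pgf (γ (i - 1)) (S.zStar i z) * pgf (S.switchArrivals (i - 1)) (S.zStar i z)
            - ((S.alpha i : ℝ) : ℂ) * z i / S.P i z (z i) *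
              pgf (γ (i - 1)) z * pgf (S.switchArrivals (i - 1)) z) ∧
      Tendsto
        (fun w => S.cycleMap i (pgf (γ (i - 1))) (pgf (S.switchArrivals (i - 1)))
          (Function.update z i w))
        (𝓝[{w | ‖w‖ ≤ 1 ∧ w ≠ 1 ∧ w ≠ S.r1 i z}] (z i)) (𝓝 (pgf (γ i) z))) := by
  refine ⟨S.r1_spec i hz, fun ν _ => ⟨S.pgf_bind_endOfVisit_eq_visitMap ν i hz, ?_⟩,
    fun β γ hss => ?_⟩
  · have : IsFiniteMeasure (ν.bind (S.endOfVisit i)) :=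
      ⟨(S.bind_endOfVisit_univ_le_one ν i).trans_lt ENNReal.one_lt_top⟩
    exact S.tendsto_of_eq_pgf _ i hz fun z' hz' =>
      S.pgf_bind_endOfVisit_eq_visitMap ν i hz'
  · have := hss.prob
    have hγ : ∀ k, IsFiniteMeasure (γ k) := fun k => ⟨by
      rw [hss.visit k]
      exact (S.bind_endOfVisit_univ_le_one (β k) k).trans_lt ENNReal.one_lt_top⟩
    have hvisit : ∀ z' : Fin M → ℂ, (∀ j, ‖z' j‖ ≤ 1) → z' i ≠ 1 → z' i ≠ S.r1 i z' →
        pgf (γ i) z' = S.visitMap i (pgf (β i)) z' := by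
      rw [hss.visit i]
      exact fun z' hz' => S.pgf_bind_endOfVisit_eq_visitMap (β i) i hz'
    have hswitch : ∀ z' : Fin M → ℂ, (∀ j, ‖z' j‖ ≤ 1) →
        pgf (β i) z' = pgf (γ (i - 1)) z' * pgf (S.switchArrivals (i - 1)) z' := by
      rw [hss.switch i]
      exact fun z' hz' => pgf_conv _ _ hz'
    have hcycle : ∀ z' : Fin M → ℂ, (∀ j, ‖z' j‖ ≤ 1) → z' i ≠ S.r1 i z' →
        pgf (γ i) z' =
          S.cycleMap i (pgf (γ (i - 1))) (pgf (S.switchArrivals (i - 1))) z' := by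
      intro z' hz' hr
      have hr1 := sub_ne_zero.2 (S.r1_ne_one i hz').symm
      have hP := S.P_ne_zero i hz' (hz' i) hr
      rw [hss.visit i, S.pgf_bind_endOfVisit (β i) i hz' hr, hswitch z' hz',
        hswitch _ (S.norm_zStar_le_one i hz'), AutonomousPolling.cycleMap]
      change _ = (S.alpha i : ℂ) * _ * _ / _ * _ * _ - (S.alpha i : ℂ) * _ / _ * _ * _
      field_simp
    exact ⟨hvisit z hz, S.tendsto_of_eq_pgf _ i hz hvisit, hswitch z hz, hcycle z hz,
      S.tendsto_of_eq_pgf _ i hz fun z' hz' _ => hcycle z' hz'⟩
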